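/- Let ${\mathbb K}$ be a field and let $E=(E^0,E^1,r,s)$ be an arbitrary directed graph. Let $A=L_{\mathbb K}(E)$ be its Leavitt path algebra: the (not necessarily unital) associative ${\mathbb K}$-algebra generated by the vertices $v\in E^0$, the edges $e\in E^1$ and the ghost edges $e^*$ ($e\in E^1$), subject to $vw=\delta_{v,w}v$; $s(e)e=e\,r(e)=e$; $r(e)e^*=e^*s(e)=e^*$; $e^*f=\delta_{e,f}r(e)$; and $v=\sum_{s(e)=v}ee^*$ for every vertex $v$ for which $s^{-1}(v)$ is finite and nonempty. The centroid ${\mathcal C}(A)$ is the ${\mathbb K}$-algebra (under composition) of all ${\mathbb K}$-linear maps $\tau\colon A\to A$ with $\tau(xy)=\tau(x)y=x\tau(y)$ for all $x,y\in A$; its elements are called centralizers. A cycle based at $u\in E^0$ is a sequence of edges $c=e_1\cdots e_n$, $n\ge 1$, with $r(e_i)=s(e_{i+1})$ for $1\le i<n$, $s(e_1)=r(e_n)=u$ and $s(e_i)\ne s(e_j)$ for $i\neq j$; an exit for $c$ is an edge $e$ such that $s(e)=s(e_i)$ and $e\ne e_i$ for some $i$. The algebra $A$ is prime if $IJ=0$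 implies $I=0$ or $J=0$ for all two-sided ideals $I,J$ of $A$. (1) If $c$ is a cycle based at $u$ and $c$ has an exit, then $\tau(u)\in{\mathbb K}u$ for every centralizer $\tau\in{\mathcal C}(A)$. (2) If $A$ is prime and $E$ contains a cycle with an exit, then ${\mathcal C}(A)\cong{\mathbb K}$ as ${\mathbb K}$-algebras. -/

import Mathlib

/-- A directed graph `(E⁰, E¹, r, s)` with vertex set `V`, edge set `Edge`, source map `s` and range
map `r`. No finiteness or countability is imposed; loops and parallel edges are allowed. -/
structure DirectedGraph (V Edge : Type*) where
  s : Edge → V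
  r : Edge → V

namespace DirectedGraph

variable {V Edge : Type*} (E : DirectedGraph V Edge)

/-- The edge word `c = e₁ ⋯ eₙ` (with `n ≥ 1`) is a cycle based at `u`: `r(eᵢ) = s(eᵢ₊₁)`,
`s(e₁) = u = r(eₙ)`, and the sources of the `eᵢ` are pairwise distinct. -/
def IsCycleAt (c : List Edge) (u : V) : Prop :=
  ∃ h : c ≠ [], c.IsChain (fun e f => E.r e = E.s f) ∧
    E.s (c.head h) = u ∧ E.r (c.getLast h) = u ∧ (c.map E.s).Nodup

/-- `e` is an exit for the path `μ = e₁ ⋯ eₙ`: `s(e) = s(eᵢ)` and `e ≠ eᵢ` for some `i`. -/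
def IsExit (e : Edge) (μ : List Edge) : Prop :=
  ∃ f ∈ μ, E.s e = E.s f ∧ e ≠ f

end DirectedGraph

/-- The generators of a Leavitt path algebra: vertices, real edges `e`, and ghost edges `e*`. -/
inductive LeavittGenerator (V Edge : Type*)
  | vertex (v : V)
  | edge (e : Edge)
  | ghost (e : Edge)

/-- The free associative non-unital `K`-algebra on the vertices, the real edges and the ghost
edges. -/
abbrev LeavittFree (K V Edge : Type*) [CommRing K] :=
  MonoidAlgebra K (FreeSemigroup (LeavittGenerator V Edge))

namespace LeavittFree

variable (K : Type*) {V Edge : Type*} [CommRing K]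

/-- A generator, as an element of the free algebra. -/
noncomputable def ofGen (g : LeavittGenerator V Edge) : LeavittFree K V Edge :=
  MonoidAlgebra.single (FreeSemigroup.of g) 1

/-- A vertex, as an element of the free algebra. -/
noncomputable def v (x : V) : LeavittFree K V Edge := ofGen K (.vertex x)

/-- A real edge, as an element of the free algebra. -/
noncomputable def e (f : Edge) : LeavittFree K V Edge := ofGen K (.edge f)

/-- A ghost edge, as an element of the free algebra. -/
noncomputable def g (f : Edge) : LeavittFree K V Edge := ofGen K (.ghost f)

end LeavittFree

open LeavittFree in
/-- The defining relations of the Leavitt path algebra: (V), (E1) for the real and for the ghost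
edges (the latter is (E2)), (CK1) and (CK2). In (CK2), `S` is the set of all edges with source `x`;
the relation is imposed when this set is finite and nonempty, that is, when `x` is regular. -/
inductive LeavittRel (K : Type*) {V Edge : Type*} [CommRing K] (E : DirectedGraph V Edge) :
    LeavittFree K V Edge → LeavittFree K V Edge → Prop
  | vertex_self (x : V) : LeavittRel K E (v K x * v K x) (v K x)
  | vertex_ne (x y : V) (h : x ≠ y) : LeavittRel K E (v K x * v K y) 0
  | source_edge (f : Edge) : LeavittRel K E (v K (E.s f) * e K f) (e K f)
  | edge_range (f : Edge) : LeavittRel K E (e K f * v K (E.r f)) (e K f)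
  | range_ghost (f : Edge) : LeavittRel K E (v K (E.r f) * g K f) (g K f)
  | ghost_source (f : Edge) : LeavittRel K E (g K f * v K (E.s f)) (g K f)
  | ck1_self (f : Edge) : LeavittRel K E (g K f * e K f) (v K (E.r f))
  | ck1_ne (f f' : Edge) (h : f ≠ f') : LeavittRel K E (g K f * e K f') 0
  | ck2 (x : V) (S : Finset Edge) (hS : ∀ f, f ∈ S ↔ E.s f = x) (hne : S.Nonempty) :
      LeavittRel K E (v K x) (∑ f ∈ S, e K f * g K f)

/-- The congruence generated by the defining relations: the smallest ring congruence that contains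
them and is stable under multiplication by scalars. -/
noncomputable def leavittCon (K : Type*) {V Edge : Type*} [CommRing K] (E : DirectedGraph V Edge) :
    RingCon (LeavittFree K V Edge) :=
  sInf {c | (∀ a b, LeavittRel K E a b → c a b) ∧
    ∀ (k : K) (a b : LeavittFree K V Edge), c a b → c (k • a) (k • b)}

theorem leavittCon_rel {K V Edge : Type*} [CommRing K] {E : DirectedGraph V Edge}
    {a b : LeavittFree K V Edge} (h : LeavittRel K E a b) : leavittCon K E a b :=
  fun _ hc => hc.1 a b h

theorem leavittCon_smul {K V Edge : Type*} [CommRing K] {E : DirectedGraph V Edge} (k : K)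
    (a b : LeavittFree K V Edge) (h : leavittCon K E a b) :
    leavittCon K E (k • a) (k • b) :=
  fun c hc => hc.2 k a b (h c hc)

/-- The Leavitt path algebra `L_K(E)`, a (not necessarily unital) associative `K`-algebra: the free
algebra on vertices, real edges and ghost edges modulo the defining relations. -/
def LeavittPathAlgebra (K : Type*) {V Edge : Type*} [CommRing K] (E : DirectedGraph V Edge) :=
  (leavittCon K E).Quotient

namespace LeavittPathAlgebra

variable {K V Edge : Type*} [CommRing K] {E : DirectedGraph V Edge}

noncomputable instance : NonUnitalRing (LeavittPathAlgebra K E) :=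
  inferInstanceAs (NonUnitalRing (leavittCon K E).Quotient)

/-- The class in `L_K(E)` of an element of the free algebra. -/
noncomputable def mk (a : LeavittFree K V Edge) : LeavittPathAlgebra K E :=
  (a : (leavittCon K E).Quotient)

noncomputable instance : SMul K (LeavittPathAlgebra K E) :=
  ⟨(leavittCon K E).smulAux leavittCon_smul⟩

theorem mk_surjective : Function.Surjective (mk : _ → LeavittPathAlgebra K E) :=
  Quotient.mk''_surjective

theorem mk_eq_mk {a b : LeavittFree K V Edge} :
    (mk a : LeavittPathAlgebra K E) = mk b ↔ leavittCon K E a b :=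
  RingCon.eq _

theorem mk_smul (k : K) (a : LeavittFree K V Edge) :
    (mk (k • a) : LeavittPathAlgebra K E) = k • mk a := rfl

theorem mk_add (a b : LeavittFree K V Edge) :
    (mk (a + b) : LeavittPathAlgebra K E) = mk a + mk b := rfl

theorem mk_mul (a b : LeavittFree K V Edge) :
    (mk (a * b) : LeavittPathAlgebra K E) = mk a * mk b := rfl

theorem mk_zero : (mk 0 : LeavittPathAlgebra K E) = 0 := rfl

noncomputable instance : Module K (LeavittPathAlgebra K E) where
  one_smul x := by
    obtain ⟨a, rfl⟩ := mk_surjective x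
    rw [← mk_smul, one_smul]
  mul_smul k l x := by
    obtain ⟨a, rfl⟩ := mk_surjective x
    simp only [← mk_smul, mul_smul]
  smul_zero k := by rw [← mk_zero, ← mk_smul, smul_zero]
  smul_add k x y := by
    obtain ⟨a, rfl⟩ := mk_surjective x
    obtain ⟨b, rfl⟩ := mk_surjective y
    simp only [← mk_smul, ← mk_add, smul_add]
  add_smul k l x := by
    obtain ⟨a, rfl⟩ := mk_surjective x
    simp only [← mk_smul, ← mk_add, add_smul]
  zero_smul x := by
    obtain ⟨a, rfl⟩ := mk_surjective x
    rw [← mk_smul, zero_smul, mk_zero]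

instance : IsScalarTower K (LeavittPathAlgebra K E) (LeavittPathAlgebra K E) where
  smul_assoc k x y := by
    obtain ⟨a, rfl⟩ := mk_surjective x
    obtain ⟨b, rfl⟩ := mk_surjective y
    simp only [smul_eq_mul, ← mk_smul, ← mk_mul, smul_mul_assoc]

instance : SMulCommClass K (LeavittPathAlgebra K E) (LeavittPathAlgebra K E) where
  smul_comm k x y := by
    obtain ⟨a, rfl⟩ := mk_surjective x
    obtain ⟨b, rfl⟩ := mk_surjective y
    simp only [smul_eq_mul, ← mk_smul, ← mk_mul, mul_smul_comm]

variable (K E)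

/-- A vertex of `E`, as an element of `L_K(E)`. -/
noncomputable def vertex (x : V) : LeavittPathAlgebra K E := mk (LeavittFree.v K x)

end LeavittPathAlgebra

/-- The centroid of a (not necessarily unital) `K`-algebra `A`: the `K`-algebra, under composition,
of all `K`-linear maps `τ : A → A` with `τ(xy) = τ(x)y = xτ(y)` for all `x, y`. Its elements are the
centralizers of `A`. -/
def algebraCentroid (K A : Type*) [CommRing K] [NonUnitalRing A] [Module K A]
    [IsScalarTower K A A] [SMulCommClass K A A] : Subalgebra K (Module.End K A) where
  carrier := {τ | ∀ x y : A, τ (x * y) = τ x * y ∧ τ (x * y) = x * τ y}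
  mul_mem' {σ τ} hσ hτ x y := by
    constructor
    · rw [Module.End.mul_apply, (hτ x y).1, (hσ _ _).1, Module.End.mul_apply]
    · rw [Module.End.mul_apply, (hτ x y).2, (hσ _ _).2, Module.End.mul_apply]
  add_mem' {σ τ} hσ hτ x y := by
    constructor
    · rw [LinearMap.add_apply, (hσ x y).1, (hτ x y).1, LinearMap.add_apply, add_mul]
    · rw [LinearMap.add_apply, (hσ x y).2, (hτ x y).2, LinearMap.add_apply, mul_add]
  algebraMap_mem' k x y := by
    simp only [Module.algebraMap_end_apply, smul_mul_assoc, mul_smul_comm, and_self]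

/-- `A` is prime: if the product of two two-sided ideals is zero, then one of them is zero.
(For a `K`-algebra it makes no difference whether ideals are required to be `K`-subspaces:
if `IJ = 0` then also `(KI)(KJ) = 0`.) -/
def IsPrimeRing (A : Type*) [NonUnitalRing A] : Prop :=
  ∀ I J : TwoSidedIdeal A, (∀ x ∈ I, ∀ y ∈ J, x * y = 0) → I = ⊥ ∨ J = ⊥

/-! Rotate the cycle so that it becomes a closed path `c` based at the source `u` of the exit `f`;
since the sources on the cycle are distinct, `f` is not an edge of `c`. For a centralizer `τ`, the
element `a = τ(u)` lies in the corner at `u` and commutes with all of it. The algebra is spanned by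
monomials `μ v ν*`, so for large `N` the powers of `c` absorb all ghost edges and `a c^N` is a
combination of real words. Commutation gives `(c*)^M (a c^N) c^M = a c^N`. For large `M` the left
side involves only suffixes of `c^M`, so `a c^N` is a combination of words avoiding `f`.

For distinct words `w`, `w'` avoiding `f`, neither of `wf`, `w'f` is a prefix of the other, so `f*
w* w' f = 0`. Therefore `f* a f = f* (c*)^N (a c^N) f = k r(f)`, and, as `a` commutes with `f f*`,
`a f = k f`. Then `(a c^N - k c^N) f = 0`. Right multiplication by `f` is injective on combinations
of words at `u` avoiding `f`, so `a c^N = k c^N`, and cancelling `c^N` gives `a = k u`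
(`CohnFamily.eq_smul_of_commute`). The scalar is carried along the cycle by `τ(r(e)) = e* τ(s(e))
e`.

In the prime case, `τ - k` kills `u`, which is nonzero (`vertex_ne_zero`, by an explicit
representation). The kernel and range of a centralizer are ideals with product zero, so `τ = k`.

The word calculus uses no (CK2); that relation matters only for checking the representation. Working
in the unitization lets the empty word be `1`. -/

/-- Elements of a unital ring satisfying the defining relations of the Leavitt path algebra of `E`,
except possibly (CK2). -/
structure CohnFamily {V Edge : Type*} (E : DirectedGraph V Edge) (B : Type*) [Ring B] where
  p : V → B
  x : Edge → B
  y : Edge → B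
  p_mul_self (v : V) : p v * p v = p v
  p_mul_ne (v w : V) (h : v ≠ w) : p v * p w = 0
  p_mul_x (e : Edge) : p (E.s e) * x e = x e
  x_mul_p (e : Edge) : x e * p (E.r e) = x e
  p_mul_y (e : Edge) : p (E.r e) * y e = y e
  y_mul_p (e : Edge) : y e * p (E.s e) = y e
  y_mul_x_self (e : Edge) : y e * x e = p (E.r e)
  y_mul_x_ne (e f : Edge) (h : e ≠ f) : y e * x f = 0

/-! ### Paths as edge words -/

namespace DirectedGraph

variable {V Edge : Type*} (E : DirectedGraph V Edge)

/-- The edge word `l` is a path from `v` to `w`. -/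
def IsPath : V → List Edge → V → Prop
  | v, [], w => v = w
  | v, e :: l, w => E.s e = v ∧ IsPath (E.r e) l w

variable {E}

theorem IsPath.append {l m : List Edge} {u v w : V} (hl : E.IsPath u l v) (hm : E.IsPath v m w) :
    E.IsPath u (l ++ m) w := by
  induction l generalizing u with
  | nil => cases hl; exact hm
  | cons e l ih => exact ⟨hl.1, ih hl.2⟩

theorem IsPath.flatten_replicate {c : List Edge} {u : V} (h : E.IsPath u c u) (n : ℕ) :
    E.IsPath u (List.replicate n c).flatten u := by
  induction n with
  | zero => rfl
  | succ n ih => exact h.append ih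

theorem IsPath.split {l m : List Edge} {u w : V} (h : E.IsPath u (l ++ m) w) :
    ∃ v, E.IsPath u l v ∧ E.IsPath v m w := by
  induction l generalizing u with
  | nil => exact ⟨u, rfl, h⟩
  | cons e l ih =>
    obtain ⟨v, h1, h2⟩ := ih h.2
    exact ⟨v, ⟨h.1, h1⟩, h2⟩

theorem isPath_of_isChain {c : List Edge} (h : c ≠ [])
    (hc : c.IsChain (fun e f => E.r e = E.s f)) :
    E.IsPath (E.s (c.head h)) c (E.r (c.getLast h)) := by
  induction c with
  | nil => exact absurd rfl h
  | cons e l ih =>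
    cases l with
    | nil => exact ⟨rfl, rfl⟩
    | cons f m =>
      rw [List.isChain_cons_cons] at hc
      refine ⟨rfl, ?_⟩
      rw [hc.1]
      exact ih (List.cons_ne_nil _ _) hc.2

end DirectedGraph

/-! ### Cancellation between ghost words and real words -/

namespace CohnFamily

variable {V Edge : Type*} {E : DirectedGraph V Edge} {B : Type*} [Ring B] (F : CohnFamily E B)

/-- The product `e₁ ⋯ eₙ` of the edges of a word. -/
def real : List Edge → B
  | [] => 1
  | e :: l => F.x e * real l

/-- The product `eₙ* ⋯ e₁*` of the ghost edges of a word. -/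
def ghost : List Edge → B
  | [] => 1
  | e :: l => ghost l * F.y e

theorem real_append (l m : List Edge) : F.real (l ++ m) = F.real l * F.real m := by
  induction l with
  | nil => simp [real]
  | cons e l ih => simp [real, ih, mul_assoc]

theorem ghost_append (l m : List Edge) : F.ghost (l ++ m) = F.ghost m * F.ghost l := by
  induction l with
  | nil => simp [ghost]
  | cons e l ih => simp [ghost, ih, mul_assoc]

theorem real_flatten_replicate (c : List Edge) (n : ℕ) :
    F.real (List.replicate n c).flatten = F.real c ^ n := by
  induction n with
  | zero => simp [real]
  | succ n ih => rw [List.replicate_succ, List.flatten_cons, real_append, ih, pow_succ']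

theorem p_mul_x_ne {v : V} {e : Edge} (h : v ≠ E.s e) : F.p v * F.x e = 0 := by
  rw [← F.p_mul_x, ← mul_assoc, F.p_mul_ne _ _ h, zero_mul]

theorem y_mul_p_ne {v : V} {e : Edge} (h : v ≠ E.s e) : F.y e * F.p v = 0 := by
  rw [← F.y_mul_p, mul_assoc, F.p_mul_ne _ _ h.symm, mul_zero]

theorem y_mul_p_mul_x (e e' : Edge) (v : V) :
    F.y e * F.p v * F.x e' = 0 ∨ (v = E.s e ∧ e = e' ∧ F.y e * F.p v * F.x e' = F.p (E.r e)) := by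
  by_cases hv : v = E.s e
  · subst hv
    rw [F.y_mul_p]
    by_cases he : e = e'
    · subst he
      exact .inr ⟨rfl, rfl, F.y_mul_x_self e⟩
    · exact .inl (F.y_mul_x_ne _ _ he)
  · rw [F.y_mul_p_ne hv, zero_mul]
    exact .inl rfl

/-- Each real letter either cancels a ghost letter or kills the product. The intermediate vertex is
arbitrary because each cancellation leaves a new one, `r(e)`. -/
theorem ghost_mul_real_of_length_le {m l : List Edge} (h : m.length ≤ l.length) (v v' : V) :
    F.ghost l * F.p v' * F.real m * F.p v = 0 ∨
      ∃ w, w <:+ l ∧ F.ghost l * F.p v' * F.real m * F.p v = F.ghost w * F.p v := by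
  induction m generalizing l v' with
  | nil =>
    by_cases hv : v' = v
    · subst hv
      exact .inr ⟨l, List.suffix_rfl, by simp [real, mul_assoc, F.p_mul_self]⟩
    · exact .inl (by simp [real, mul_assoc, F.p_mul_ne _ _ hv])
  | cons e' m ih =>
    cases l with
    | nil => simp at h
    | cons e l =>
      have key : F.ghost (e :: l) * F.p v' * F.real (e' :: m) * F.p v
          = F.ghost l * (F.y e * F.p v' * F.x e') * F.real m * F.p v := by
        simp only [real, ghost, mul_assoc]
      rw [key]
      rcases F.y_mul_p_mul_x e e' v' with h0 | ⟨-, -, h1⟩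
      · rw [h0]; exact .inl (by simp)
      · rw [h1]
        rcases ih (by simpa using h) (E.r e) with h2 | ⟨w, hw, h2⟩
        · exact .inl h2
        · exact .inr ⟨w, hw.trans (List.suffix_cons _ _), h2⟩

theorem ghost_mul_real_of_le_length {m l : List Edge} (h : m.length ≤ l.length) (v v' : V) :
    F.p v * F.ghost m * F.p v' * F.real l = 0 ∨
      ∃ w, w <:+ l ∧ F.p v * F.ghost m * F.p v' * F.real l = F.p v * F.real w := by
  induction m generalizing l v' with
  | nil =>
    by_cases hv : v = v'
    · subst hv
      exact .inr ⟨l, List.suffix_rfl, by simp [ghost, F.p_mul_self]⟩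
    · exact .inl (by simp [ghost, F.p_mul_ne _ _ hv])
  | cons e m ih =>
    cases l with
    | nil => simp at h
    | cons e' l =>
      have key : F.p v * F.ghost (e :: m) * F.p v' * F.real (e' :: l)
          = F.p v * F.ghost m * (F.y e * F.p v' * F.x e') * F.real l := by
        simp only [real, ghost, mul_assoc]
      rw [key]
      rcases F.y_mul_p_mul_x e e' v' with h0 | ⟨-, -, h1⟩
      · rw [h0]; exact .inl (by simp)
      · rw [h1]
        rcases ih (by simpa using h) (E.r e) with h2 | ⟨w, hw, h2⟩
        · exact .inl h2
        · exact .inr ⟨w, hw.trans (List.suffix_cons _ _), h2⟩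

/-- The final `f` acts as an end marker: neither of `wf`, `w'f` is a prefix of the other, so
cancellation must meet two different letters. -/
theorem ghost_mul_real_of_ne {f : Edge} {w w' : List Edge} (hw : f ∉ w) (hw' : f ∉ w')
    (h : w ≠ w') (v : V) : F.y f * F.ghost w * F.p v * F.real w' * F.x f = 0 := by
  induction w generalizing w' v with
  | nil =>
    cases w' with
    | nil => exact absurd rfl h
    | cons e' m =>
      have key : F.y f * F.ghost [] * F.p v * F.real (e' :: m) * F.x f
          = (F.y f * F.p v * F.x e') * F.real m * F.x f := by
        simp only [real, ghost, mul_assoc, one_mul]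
      rw [key]
      rcases F.y_mul_p_mul_x f e' v with h0 | ⟨-, h1, -⟩
      · simp [h0]
      · simp [h1] at hw'
  | cons e w ih =>
    cases w' with
    | nil =>
      have key : F.y f * F.ghost (e :: w) * F.p v * F.real [] * F.x f
          = F.y f * F.ghost w * (F.y e * F.p v * F.x f) := by
        simp only [real, ghost, mul_assoc, one_mul]
      rw [key]
      rcases F.y_mul_p_mul_x e f v with h0 | ⟨-, h1, -⟩
      · simp [h0]
      · simp [h1] at hw
    | cons e' m =>
      have key : F.y f * F.ghost (e :: w) * F.p v * F.real (e' :: m) * F.x f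
          = F.y f * F.ghost w * (F.y e * F.p v * F.x e') * F.real m * F.x f := by
        simp only [real, ghost, mul_assoc]
      rw [key]
      rcases F.y_mul_p_mul_x e e' v with h0 | ⟨-, h1, h2⟩
      · simp [h0]
      · rw [h2]
        exact ih (fun h => hw (List.mem_cons_of_mem _ h)) (fun h => hw' (List.mem_cons_of_mem _ h))
          (fun h' => h (by rw [h1, h'])) _

/-- Words are arbitrary lists: one that is not a path from `v` to `u` contributes zero, and a
genuine path is cancelled by its ghost. -/
theorem p_mul_real_mul_p_eq_zero_or (v u : V) (w : List Edge) :
    F.p v * F.real w * F.p u = 0 ∨ F.p u * F.ghost w * F.p v * F.real w * F.p u = F.p u := by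
  induction w generalizing v with
  | nil =>
    by_cases hv : v = u
    · subst hv
      exact .inr (by simp [real, ghost, F.p_mul_self])
    · exact .inl (by simp [real, F.p_mul_ne _ _ hv])
  | cons e w ih =>
    by_cases hv : v = E.s e
    · subst hv
      have h1 : F.p (E.s e) * F.real (e :: w) * F.p u
          = F.x e * (F.p (E.r e) * F.real w * F.p u) := by
        simp only [real, ← mul_assoc, F.p_mul_x, F.x_mul_p]
      have h2 : F.p u * F.ghost (e :: w) * F.p (E.s e) * F.real (e :: w) * F.p u
          = F.p u * F.ghost w * (F.y e * F.p (E.s e) * F.x e) * F.real w * F.p u := by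
        simp only [real, ghost, mul_assoc]
      rw [h1, h2, F.y_mul_p, F.y_mul_x_self]
      exact (ih (E.r e)).imp (fun h => by rw [h, mul_zero]) id
    · left
      simp only [real, ← mul_assoc, F.p_mul_x_ne hv, zero_mul]

theorem p_mul_real_mul_p_eq (v u : V) (w : List Edge) :
    F.p v * F.real w * F.p u = 0 ∨ F.p v * F.real w * F.p u = F.p v * F.real w := by
  induction w generalizing v with
  | nil =>
    by_cases hv : v = u
    · subst hv
      exact .inr (by simp [real, F.p_mul_self])
    · exact .inl (by simp [real, F.p_mul_ne _ _ hv])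
  | cons e w ih =>
    have h1 : F.real (e :: w) = F.x e * (F.p (E.r e) * F.real w) := by
      simp only [real, ← mul_assoc, F.x_mul_p]
    rw [h1, mul_assoc, mul_assoc]
    rcases ih (E.r e) with h | h <;> rw [h]
    · exact .inl (by simp)
    · exact .inr rfl

theorem p_mul_real_of_isPath {u v : V} {l : List Edge} (h : E.IsPath u l v) :
    F.p u * F.real l = F.real l * F.p v := by
  induction l generalizing u with
  | nil => cases h; simp [real]
  | cons e l ih =>
    obtain ⟨rfl, h⟩ := h
    rw [real, ← mul_assoc, F.p_mul_x, mul_assoc, ← ih h, ← mul_assoc, F.x_mul_p]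

theorem ghost_mul_real_of_isPath {u v : V} {l : List Edge} (h : E.IsPath u l v) :
    F.ghost l * F.p u * F.real l = F.p v := by
  induction l generalizing u with
  | nil => cases h; simp [real, ghost]
  | cons e l ih =>
    obtain ⟨rfl, h⟩ := h
    have key : F.ghost (e :: l) * F.p (E.s e) * F.real (e :: l)
        = F.ghost l * (F.y e * F.p (E.s e) * F.x e) * F.real l := by
      simp only [real, ghost, mul_assoc]
    rw [key, F.y_mul_p, F.y_mul_x_self, ih h]

theorem le_length_flatten_replicate {c : List Edge} (hc : c ≠ []) (n : ℕ) :
    n ≤ (List.replicate n c).flatten.length := by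
  have := List.length_pos_iff.2 hc
  simpa using Nat.le_mul_of_pos_right n this

/-! ### Spans of words and central elements of a corner -/

section Algebra

variable (K : Type*) [Field K] [Algebra K B]

/-- The span of the elements `μ v ν*`, where `μ` and `ν` are edge words and `v` is a vertex. -/
def monomialSpan : Submodule K B :=
  Submodule.span K {b | ∃ (l m : List Edge) (v : V), b = F.real l * F.p v * F.ghost m}

/-- The span of the elements `u w u`, where `w` is an edge word in `S`. -/
def realSpan (u : V) (S : Set (List Edge)) : Submodule K B :=
  Submodule.span K ((fun w => F.p u * F.real w * F.p u) '' S)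

variable {K}

theorem realSpan_mem {u : V} {S : Set (List Edge)} {w : List Edge} (hw : w ∈ S) :
    F.p u * F.real w * F.p u ∈ F.realSpan K u S :=
  Submodule.subset_span ⟨w, hw, rfl⟩

/-- Left multiplication of `z f` by `f* w*` isolates the coefficient of `w`, because all other words
avoiding `f` are annihilated. -/
theorem eq_zero_of_mul_x_eq_zero {f : Edge} {u : V} (hu : E.s f = u) (hr : F.p (E.r f) ≠ 0) {z : B}
    (hz : z ∈ F.realSpan K u {w | f ∉ w}) (h : z * F.x f = 0) : z = 0 := by
  obtain ⟨c, hc, rfl⟩ := (Finsupp.mem_span_image_iff_linearCombination K).1 hz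
  rw [Finsupp.mem_supported] at hc
  rw [Finsupp.linearCombination_apply, Finsupp.sum] at h ⊢
  refine Finset.sum_eq_zero fun w hw => ?_
  rcases F.p_mul_real_mul_p_eq_zero_or u u w with h0 | h1
  · simp [h0]
  · exfalso
    have hx : F.p u * F.x f = F.x f := by rw [← hu, F.p_mul_x]
    have hy : F.y f * F.p u = F.y f := by rw [← hu, F.y_mul_p]
    have hoff : ∀ w' ∈ c.support, w' ≠ w →
        F.y f * F.ghost w * (c w' • (F.p u * F.real w' * F.p u) * F.x f) = 0 := by
      intro w' hw' hne
      have := F.ghost_mul_real_of_ne (hc hw) (hc hw') hne.symm u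
      rw [smul_mul_assoc, mul_smul_comm, mul_assoc _ (F.p u) (F.x f), hx, ← mul_assoc, ← mul_assoc,
        this, smul_zero]
    have hon : F.y f * F.ghost w * (c w • (F.p u * F.real w * F.p u) * F.x f) = 0 := by
      rw [← Finset.sum_eq_single_of_mem (f := fun w' =>
        F.y f * F.ghost w * (c w' • (F.p u * F.real w' * F.p u) * F.x f)) w hw hoff,
        ← Finset.mul_sum, ← Finset.sum_mul, h, mul_zero]
    have hval : F.y f * F.ghost w * ((F.p u * F.real w * F.p u) * F.x f) = F.p (E.r f) := by
      have key : F.y f * F.p u * F.ghost w * (F.p u * F.real w * F.p u * F.x f)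
          = F.y f * (F.p u * F.ghost w * F.p u * F.real w * F.p u) * F.x f := by
        simp only [mul_assoc]
      rw [← hy, key, h1, hy, F.y_mul_x_self]
    rw [smul_mul_assoc, mul_smul_comm, hval] at hon
    exact (smul_ne_zero (Finsupp.mem_support_iff.1 hw) hr) hon

/-- In `μ v ν*`, the ghost part is absorbed by `c^n` once `n ≥ |ν|`. Stating this eventually in `n`
gives one exponent for a whole linear combination. -/
theorem eventually_mul_real_mem {u : V} {c : List Edge} (hc : c ≠ []) {a : B}
    (ha : a ∈ F.monomialSpan K) : ∀ᶠ n in Filter.atTop,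
      F.p u * a * F.p u * F.real (List.replicate n c).flatten * F.p u ∈
        F.realSpan K u Set.univ := by
  induction ha using Submodule.span_induction with
  | zero => simp
  | add a b _ _ h1 h2 =>
    filter_upwards [h1, h2] with n h1 h2
    simpa only [mul_add, add_mul] using add_mem h1 h2
  | smul k a _ h =>
    filter_upwards [h] with n h
    simpa only [mul_smul_comm, smul_mul_assoc] using Submodule.smul_mem _ k h
  | mem a h =>
    obtain ⟨l, m, v, rfl⟩ := h
    filter_upwards [Filter.eventually_ge_atTop m.length] with n hn
    have hlen := hn.trans (le_length_flatten_replicate hc n)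
    have key : F.p u * (F.real l * F.p v * F.ghost m) * F.p u *
          F.real (List.replicate n c).flatten * F.p u
        = F.p u * F.real l *
          (F.p v * F.ghost m * F.p u * F.real (List.replicate n c).flatten) * F.p u := by
      simp only [mul_assoc]
    rw [key]
    rcases F.ghost_mul_real_of_le_length hlen v u with h | ⟨w, -, h⟩
    · simp [h]
    · rw [h, ← mul_assoc]
      rcases F.p_mul_real_mul_p_eq u v l with h | h
      · simp [h]
      · rw [h, mul_assoc (F.p u), ← F.real_append]
        exact F.realSpan_mem (Set.mem_univ _)

/-- When `n` is at least the length of a word, `(c*)^n` reduces it to the ghost of a suffix of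
`c^n`; multiplying by `c^n` then leaves a real suffix of `c^n`, whose letters all lie in `c`. -/
theorem eventually_ghost_mul_mul_real_mem {u : V} {c : List Edge} {f : Edge} (hc : c ≠ [])
    (hf : f ∉ c) {z : B} (hz : z ∈ F.realSpan K u Set.univ) : ∀ᶠ n in Filter.atTop,
      F.p u * F.ghost (List.replicate n c).flatten * z *
        F.real (List.replicate n c).flatten * F.p u ∈ F.realSpan K u {w | f ∉ w} := by
  induction hz using Submodule.span_induction with
  | zero => simp
  | add a b _ _ h1 h2 =>
    filter_upwards [h1, h2] with n h1 h2
    simpa only [mul_add, add_mul] using add_mem h1 h2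
  | smul k a _ h =>
    filter_upwards [h] with n h
    simpa only [mul_smul_comm, smul_mul_assoc] using Submodule.smul_mem _ k h
  | mem z h =>
    obtain ⟨m, -, rfl⟩ := h
    filter_upwards [Filter.eventually_ge_atTop m.length] with n hn
    have hlen := hn.trans (le_length_flatten_replicate hc n)
    set l := (List.replicate n c).flatten with hl
    have hfl : f ∉ l := by
      rw [hl, List.mem_flatten]
      rintro ⟨c', h1, h2⟩
      rw [List.eq_of_mem_replicate h1] at h2
      exact hf h2
    have key : F.p u * F.ghost l * (F.p u * F.real m * F.p u) * F.real l * F.p u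
        = F.p u * (F.ghost l * F.p u * F.real m * F.p u) * F.real l * F.p u := by
      simp only [mul_assoc]
    rw [key]
    rcases F.ghost_mul_real_of_length_le hlen u u with h | ⟨w, hw, h⟩
    · simp [h]
    · rw [h, ← mul_assoc]
      rcases F.ghost_mul_real_of_le_length hw.length_le u u with h | ⟨w', hw', h⟩
      · simp [h]
      · rw [h]
        exact F.realSpan_mem fun h => hfl (hw'.subset h)

/-- Only the word `l` itself survives, so `k` is its coefficient. -/
theorem exists_mul_mul_x_eq_smul {u : V} {f : Edge} {l : List Edge} (hf : f ∉ l) (hu : E.s f = u)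
    {z : B} (hz : z ∈ F.realSpan K u {w | f ∉ w}) (hl : E.IsPath u l u) :
    ∃ k : K, F.y f * F.ghost l * z * F.x f = k • F.p (E.r f) := by
  have hx : F.p u * F.x f = F.x f := by rw [← hu, F.p_mul_x]
  induction hz using Submodule.span_induction with
  | zero => exact ⟨0, by simp⟩
  | add a b _ _ h1 h2 =>
    obtain ⟨k1, h1⟩ := h1
    obtain ⟨k2, h2⟩ := h2
    exact ⟨k1 + k2, by rw [mul_add, add_mul, h1, h2, add_smul]⟩
  | smul k a _ h =>
    obtain ⟨k1, h1⟩ := h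
    exact ⟨k * k1, by rw [mul_smul_comm, smul_mul_assoc, h1, mul_smul]⟩
  | mem z h =>
    obtain ⟨w, hw, rfl⟩ := h
    have key : F.y f * F.ghost l * (F.p u * F.real w * F.p u) * F.x f
        = F.y f * (F.ghost l * F.p u * F.real w) * F.x f := by
      simp only [mul_assoc, hx]
    by_cases h : l = w
    · subst h
      exact ⟨1, by rw [key, F.ghost_mul_real_of_isPath hl, mul_assoc, hx, F.y_mul_x_self, one_smul]⟩
    · refine ⟨0, ?_⟩
      rw [key, zero_smul, ← F.ghost_mul_real_of_ne hf hw h u]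
      simp only [mul_assoc]

/-- If `u` is the base of a closed path with an exit at `u`, then the central elements of the corner
at `u` are the scalar multiples of `u`. -/
theorem eq_smul_of_commute {u : V} {c : List Edge} {f : Edge} (hc : c ≠ []) (hcu : E.IsPath u c u)
    (hf : f ∉ c) (hu : E.s f = u) (hr : F.p (E.r f) ≠ 0) {a : B} (ha : a ∈ F.monomialSpan K)
    (hua : F.p u * a = a) (hau : a * F.p u = a)
    (hcomm : ∀ b, a * (F.p u * b * F.p u) = F.p u * b * F.p u * a) :
    ∃ k : K, a = k • F.p u := by
  have hpp := F.p_mul_self u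
  have hx : F.p u * F.x f = F.x f := by rw [← hu, F.p_mul_x]
  have hy : F.y f * F.p u = F.y f := by rw [← hu, F.y_mul_p]
  have hpR (n : ℕ) : F.p u * F.real c ^ n = F.real c ^ n * F.p u := by
    rw [← F.real_flatten_replicate]
    exact F.p_mul_real_of_isPath (hcu.flatten_replicate n)
  have haR (n : ℕ) : a * F.real c ^ n = F.real c ^ n * a := by
    have := hcomm (F.real c ^ n)
    rwa [hpR, mul_assoc _ (F.p u), hpp, ← hpR, ← mul_assoc, hau, hpR, mul_assoc, hua] at this
  have hDR (n : ℕ) : F.ghost (List.replicate n c).flatten * F.p u * F.real c ^ n = F.p u := by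
    rw [← F.real_flatten_replicate]
    exact F.ghost_mul_real_of_isPath (hcu.flatten_replicate n)
  -- Move `c^n` to the left of `a`, where its ghost cancels it.
  have hDaR (n : ℕ) : F.ghost (List.replicate n c).flatten * (a * F.real c ^ n) = a := by
    rw [haR, ← hua, ← mul_assoc (F.real c ^ n), ← hpR, ← mul_assoc, ← mul_assoc, hDR]
  obtain ⟨N, hN⟩ := (F.eventually_mul_real_mem (K := K) (u := u) hc ha).exists
  obtain ⟨M, hM⟩ := (F.eventually_ghost_mul_mul_real_mem hc hf hN).exists
  rw [hua, hau, F.real_flatten_replicate, F.real_flatten_replicate] at hM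
  -- The element `a c^N` is unchanged by `z ↦ (c*)^M z c^M`, which for this `M` lands in words
  -- avoiding `f`.
  have hz : a * F.real c ^ N ∈ F.realSpan K u {w | f ∉ w} := by
    convert hM using 1
    have hM' : F.p u * F.ghost (List.replicate M c).flatten * (a * F.real c ^ N * F.p u) *
          F.real c ^ M * F.p u
        = F.p u * (F.ghost (List.replicate M c).flatten *
          (a * (F.real c ^ N * (F.p u * F.real c ^ M)) * F.p u)) := by
      simp only [mul_assoc]
    rw [hM', hpR, ← mul_assoc (F.real c ^ N), ← pow_add, add_comm, pow_add, mul_assoc (_ ^ M)]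
    have hM'' : a * (F.real c ^ M * (F.real c ^ N * F.p u)) * F.p u
        = a * F.real c ^ M * F.real c ^ N := by
      rw [mul_assoc, mul_assoc (_ ^ M), mul_assoc (_ ^ N), hpp, ← hpR, ← mul_assoc (_ ^ M), ← hpR,
        mul_assoc (F.p u), ← mul_assoc a, hau, mul_assoc]
    rw [hM'', ← mul_assoc (F.ghost _), hDaR, ← mul_assoc, hua]

  set R := F.real c ^ N with hR
  have hfl (n : ℕ) : f ∉ (List.replicate n c).flatten := by
    rw [List.mem_flatten]
    rintro ⟨c', h1, h2⟩
    rw [List.eq_of_mem_replicate h1] at h2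
    exact hf h2
  obtain ⟨k, hk⟩ := F.exists_mul_mul_x_eq_smul (hfl N) hu hz (hcu.flatten_replicate N)
  rw [mul_assoc (F.y f), hDaR] at hk
  -- Since `f f*` lies in the corner at `u`, it commutes with `a`.
  have hax : a * F.x f = k • F.x f := by
    have h1 := hcomm (F.x f * F.y f)
    rw [← mul_assoc (F.p u), hx, mul_assoc (F.x f), hy] at h1
    calc a * F.x f = a * (F.x f * F.y f) * F.x f := by
          rw [mul_assoc, mul_assoc, F.y_mul_x_self, F.x_mul_p]
      _ = F.x f * (F.y f * a * F.x f) := by rw [h1]; simp only [mul_assoc]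
      _ = k • F.x f := by rw [hk, mul_smul_comm, F.x_mul_p]
  have hpRp : F.p u * R * F.p u ∈ F.realSpan K u {w | f ∉ w} := by
    rw [hR, ← F.real_flatten_replicate]
    exact F.realSpan_mem (hfl N)
  have hzero : (a * R - k • (F.p u * R * F.p u)) * F.x f = 0 := by
    rw [sub_mul, haR, mul_assoc, hax, smul_mul_assoc, mul_assoc, hx, hpR, mul_assoc, hx,
      mul_smul_comm, sub_self]
  have hfin := F.eq_zero_of_mul_x_eq_zero hu hr (sub_mem hz (Submodule.smul_mem _ k hpRp)) hzero
  refine ⟨k, ?_⟩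
  rw [sub_eq_zero] at hfin
  rw [← hDaR N, hfin, mul_smul_comm, hpR, mul_assoc R, hpp, ← hpR, ← mul_assoc, hDR]

end Algebra

end CohnFamily

namespace LeavittPathAlgebra

/-! ### A representation in which vertices are nonzero -/

section Nontrivial

variable {V Edge : Type*} (E : DirectedGraph V Edge)

/-- There is a branching system for `E` in which all fibres are `Edge ⊕ ℕ`. -/
theorem exists_branching : ∃ φ : Edge → Edge ⊕ ℕ → Edge ⊕ ℕ,
    (∀ e e' x x', E.s e = E.s e' → φ e x = φ e' x' → e = e' ∧ x = x') ∧
      ∀ e y, ∃ e' x, E.s e' = E.s e ∧ φ e' x = y := by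
  have key (v : V) (hv : Nonempty {e // E.s e = v}) :
      Nonempty ({e // E.s e = v} × (Edge ⊕ ℕ) ≃ Edge ⊕ ℕ) := by
    -- The summand `ℕ` makes the fibre infinite and the summand `Edge` makes it at least as large as
    -- any set of edges, so the product has the cardinality of the fibre.
    rw [← Cardinal.eq, Cardinal.mk_prod, Cardinal.lift_id, Cardinal.lift_id]
    refine Cardinal.mul_eq_right (Cardinal.aleph0_le_mk _) ?_ (Cardinal.mk_ne_zero _)
    exact Cardinal.mk_le_of_injective (f := fun e => Sum.inl e.1)
      (Sum.inl_injective.comp Subtype.val_injective)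
  have eq (e : Edge) (v : V) (h : E.s e = v) (x : Edge ⊕ ℕ) :
      (key (E.s e) ⟨e, rfl⟩).some (⟨e, rfl⟩, x) = (key v ⟨e, h⟩).some (⟨e, h⟩, x) := by
    subst h; rfl
  refine ⟨fun e x => (key (E.s e) ⟨e, rfl⟩).some (⟨e, rfl⟩, x), fun e e' x x' h1 h2 => ?_,
    fun e y => ?_⟩
  · dsimp only at h2
    rw [eq e _ h1, EmbeddingLike.apply_eq_iff_eq, Prod.mk.injEq, Subtype.mk.injEq] at h2
    exact h2
  · obtain ⟨⟨⟨e', h⟩, x⟩, hx⟩ := (key (E.s e) ⟨e, rfl⟩).some.surjective y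
    exact ⟨e', x, h, by rw [← hx]; exact eq e' _ h x⟩

variable (K : Type*) [Field K]

/-- Composition with a partial map, as an operator on functions. -/
def compPartial {Z : Type*} (σ : Z → Option Z) : Module.End K (Z → K) where
  toFun g z := (σ z).elim 0 g
  map_add' g h := by
    ext z
    cases hz : σ z <;> simp [hz]
  map_smul' k g := by
    ext z
    cases hz : σ z <;> simp [hz]

theorem compPartial_apply {Z : Type*} (σ : Z → Option Z) (g : Z → K) (z : Z) :
    compPartial K σ g z = (σ z).elim 0 g := rfl

theorem compPartial_mul {Z : Type*} (σ τ : Z → Option Z) :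
    compPartial K σ * compPartial K τ = compPartial K fun z => (σ z).bind τ := by
  ext g z
  rw [Module.End.mul_apply, compPartial_apply, compPartial_apply]
  cases σ z <;> rfl

theorem compPartial_none {Z : Type*} : compPartial K (fun _ : Z => none) = 0 := rfl

/-- Relations that hold in the image of a non-unital algebra homomorphism out of the free algebra
descend to the Leavitt congruence. -/
theorem map_eq_of_leavittCon {A : Type*} [Ring A] [Algebra K A] {E : DirectedGraph V Edge}
    (φ : LeavittFree K V Edge →ₙₐ[K] A) (h : ∀ a b, LeavittRel K E a b → φ a = φ b)
    {a b : LeavittFree K V Edge} (hab : leavittCon K E a b) : φ a = φ b := by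
  -- The kernel congruence of `φ` belongs to the family whose infimum is `leavittCon`.
  refine hab (TwoSidedIdeal.ker φ).ringCon ⟨h, fun k a b hab => ?_⟩
  rw [TwoSidedIdeal.ker_ringCon] at hab ⊢
  rw [map_smul, map_smul, hab]

/-- The algebra acts on functions on `V × (Edge ⊕ ℕ)`. The maps `j e` embed the fibre over `r(e)`
into the fibre over `s(e)` with disjoint images, which cover the fibre over every vertex that emits
an edge; this covering gives (CK2). -/
theorem vertex_ne_zero (v : V) : vertex K E v ≠ 0 := by
  classical
  obtain ⟨φ, hinj, hsurj⟩ := exists_branching E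
  let j (e : Edge) (x : Edge ⊕ ℕ) : V × (Edge ⊕ ℕ) := (E.s e, φ e x)
  have hj (e e' x x') : j e x = j e' x' → e = e' ∧ x = x' := fun h =>
    hinj e e' x x' (congrArg Prod.fst h) (congrArg Prod.snd h)
  have hji (e) : Function.Injective (j e) := fun x x' h => (hj e e x x' h).2
  -- Precomposition reverses order, so in a product the left factor moves the point first: an edge
  -- undoes `j e` and a ghost edge applies it.
  let σ : LeavittGenerator V Edge → V × (Edge ⊕ ℕ) → Option (V × (Edge ⊕ ℕ))
    | .vertex v => fun z => if z.1 = v then some z else none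
    | .edge e => fun z => (Function.partialInv (j e) z).map (E.r e, ·)
    | .ghost e => fun z => if z.1 = E.r e then some (j e z.2) else none
  have hσe (e x) : σ (.edge e) (j e x) = some (E.r e, x) := by
    simp only [σ, Function.partialInv_left (hji e), Option.map_some]
  have hσn (e z) (h : ∀ x, j e x ≠ z) : σ (.edge e) z = none := by
    simp only [σ, Option.map_eq_none_iff]
    rw [Option.eq_none_iff_forall_ne_some]
    exact fun x hx => h x (((hji e).isPartialInv x z).1 hx)
  let ρ : LeavittFree K V Edge →ₙₐ[K] Module.End K (V × (Edge ⊕ ℕ) → K) :=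
    MonoidAlgebra.liftMagma K (FreeSemigroup.lift fun g => compPartial K (σ g))
  have hρ (g) : ρ (LeavittFree.ofGen K g) = compPartial K (σ g) := by
    simp [ρ, LeavittFree.ofGen]
  have hrel : ∀ a b, LeavittRel K E a b → ρ a = ρ b := by
    intro a b hab
    induction hab with
    | vertex_self x =>
      rw [map_mul, LeavittFree.v, hρ, compPartial_mul]
      congr 1
      ext1 z
      by_cases h : z.1 = x <;> simp [σ, h]
    | vertex_ne x y hne =>
      rw [map_mul, LeavittFree.v, LeavittFree.v, hρ, hρ, compPartial_mul, map_zero,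
        ← compPartial_none]
      congr 1
      ext1 z
      by_cases h : z.1 = x
      · simp [σ, h, hne]
      · simp [σ, h]
    | source_edge f =>
      rw [map_mul, LeavittFree.v, LeavittFree.e, hρ, hρ, compPartial_mul]
      congr 1
      ext1 z
      by_cases h : z.1 = E.s f
      · simp [σ, h]
      · rw [hσn f z (fun x hx => h (by rw [← hx]))]
        simp [σ, h]
    | edge_range f =>
      rw [map_mul, LeavittFree.v, LeavittFree.e, hρ, hρ, compPartial_mul]
      congr 1
      ext1 z
      by_cases h : ∃ x, j f x = z
      · obtain ⟨x, rfl⟩ := h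
        rw [hσe]
        simp [σ]
      · rw [hσn f z (not_exists.1 h)]
        rfl
    | range_ghost f =>
      rw [map_mul, LeavittFree.v, LeavittFree.g, hρ, hρ, compPartial_mul]
      congr 1
      ext1 z
      by_cases h : z.1 = E.r f <;> simp [σ, h]
    | ghost_source f =>
      rw [map_mul, LeavittFree.v, LeavittFree.g, hρ, hρ, compPartial_mul]
      congr 1
      ext1 z
      by_cases h : z.1 = E.r f <;> simp [σ, h, j]
    | ck1_self f =>
      rw [map_mul, LeavittFree.v, LeavittFree.g, LeavittFree.e, hρ, hρ, hρ, compPartial_mul]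
      congr 1
      ext1 z
      by_cases h : z.1 = E.r f
      · have : σ (.ghost f) z = some (j f z.2) := by simp [σ, h]
        rw [this, Option.bind_some, hσe, ← h]
        simp [σ]
      · simp [σ, h]
    | ck1_ne f f' hne =>
      rw [map_mul, LeavittFree.g, LeavittFree.e, hρ, hρ, compPartial_mul, map_zero,
        ← compPartial_none]
      congr 1
      ext1 z
      by_cases h : z.1 = E.r f
      · have : σ (.ghost f) z = some (j f z.2) := by simp [σ, h]
        rw [this, Option.bind_some, hσn]
        exact fun x hx => hne (hj _ _ _ _ hx).1.symm
      · simp [σ, h]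
    | ck2 x S hS hne =>
      rw [map_sum, LeavittFree.v, hρ]
      refine LinearMap.ext fun g => funext fun z => ?_
      rw [LinearMap.sum_apply, Finset.sum_apply]
      have hterm (f) : ρ (LeavittFree.e K f * LeavittFree.g K f) g z
          = if ∃ y, j f y = z then g z else 0 := by
        rw [map_mul, LeavittFree.e, LeavittFree.g, hρ, hρ, compPartial_mul, compPartial_apply]
        split_ifs with h
        · obtain ⟨y, rfl⟩ := h
          rw [hσe]
          simp [σ]
        · rw [hσn f z (not_exists.1 h)]
          rfl
      simp only [hterm, compPartial_apply]
      by_cases h : z.1 = x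
      · obtain ⟨e₀, he₀⟩ := hne
        obtain ⟨e, y, h1, h2⟩ := hsurj e₀ z.2
        rw [(hS e₀).1 he₀] at h1
        have hz : j e y = z := Prod.ext (h1.trans h.symm) h2
        rw [Finset.sum_eq_single_of_mem e ((hS e).2 h1), if_pos ⟨y, hz⟩]
        · simp [σ, h]
        · rintro e' - hne'
          rw [if_neg]
          rintro ⟨y', hy'⟩
          exact hne' (hj _ _ _ _ (hy'.trans hz.symm)).1
      · rw [Finset.sum_eq_zero]
        · simp [σ, h]
        · intro f hf
          rw [if_neg]
          rintro ⟨y, rfl⟩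
          exact h ((hS f).1 hf)
  intro h0
  rw [vertex, ← mk_zero, mk_eq_mk] at h0
  have h1 := map_eq_of_leavittCon K ρ hrel h0
  rw [map_zero, LeavittFree.v, hρ] at h1
  -- The point `Sum.inr 0` exists even when there are no edges.
  have h2 := congrFun (LinearMap.congr_fun h1 1) (v, Sum.inr 0)
  rw [compPartial_apply] at h2
  simp [σ] at h2

end Nontrivial

/-! ### Monomials span the Leavitt path algebra; centralizers at vertices -/

section Family

variable {K V Edge : Type*} [Field K] (E : DirectedGraph V Edge)

theorem mk_eq_mk_of_rel {a b : LeavittFree K V Edge} (h : LeavittRel K E a b) :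
    (mk a : LeavittPathAlgebra K E) = mk b :=
  mk_eq_mk.2 (leavittCon_rel h)

variable (K)

/-- The generators of `L_K(E)` in its unitization. -/
noncomputable def family : CohnFamily E (Unitization K (LeavittPathAlgebra K E)) where
  p v := (vertex K E v : LeavittPathAlgebra K E)
  x e := (mk (LeavittFree.e K e) : LeavittPathAlgebra K E)
  y e := (mk (LeavittFree.g K e) : LeavittPathAlgebra K E)
  p_mul_self v := by
    rw [← Unitization.inr_mul, vertex, ← mk_mul, mk_eq_mk_of_rel E (.vertex_self v)]
  p_mul_ne v w h := by
    rw [← Unitization.inr_mul, vertex, vertex, ← mk_mul, mk_eq_mk_of_rel E (.vertex_ne v w h),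
      mk_zero, Unitization.inr_zero]
  p_mul_x e := by
    rw [← Unitization.inr_mul, vertex, ← mk_mul, mk_eq_mk_of_rel E (.source_edge e)]
  x_mul_p e := by
    rw [← Unitization.inr_mul, vertex, ← mk_mul, mk_eq_mk_of_rel E (.edge_range e)]
  p_mul_y e := by
    rw [← Unitization.inr_mul, vertex, ← mk_mul, mk_eq_mk_of_rel E (.range_ghost e)]
  y_mul_p e := by
    rw [← Unitization.inr_mul, vertex, ← mk_mul, mk_eq_mk_of_rel E (.ghost_source e)]
  y_mul_x_self e := by
    rw [← Unitization.inr_mul, vertex, ← mk_mul, mk_eq_mk_of_rel E (.ck1_self e)]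
  y_mul_x_ne e f h := by
    rw [← Unitization.inr_mul, ← mk_mul, mk_eq_mk_of_rel E (.ck1_ne e f h), mk_zero,
      Unitization.inr_zero]

theorem p_mul_monomial_mem {B : Type*} [Ring B] [Algebra K B] (F : CohnFamily E B) (w v : V)
    (l m : List Edge) : F.p w * (F.real l * F.p v * F.ghost m) ∈ F.monomialSpan K := by
  cases l with
  | nil =>
    by_cases h : w = v
    · subst h
      refine Submodule.subset_span ⟨[], m, w, ?_⟩
      simp only [CohnFamily.real, one_mul, ← mul_assoc, CohnFamily.p_mul_self]
    · convert Submodule.zero_mem _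
      simp only [CohnFamily.real, one_mul, ← mul_assoc, CohnFamily.p_mul_ne _ _ _ h, zero_mul]
  | cons e l =>
    by_cases h : w = E.s e
    · subst h
      refine Submodule.subset_span ⟨e :: l, m, v, ?_⟩
      simp only [CohnFamily.real, ← mul_assoc, CohnFamily.p_mul_x]
    · convert Submodule.zero_mem _
      simp only [CohnFamily.real, ← mul_assoc, CohnFamily.p_mul_x_ne _ h, zero_mul]

/-- Stability under left multiplication by generators is what the induction on words in
`inr_mem_monomialSpan` needs. -/
theorem inr_ofGen_mul_mem (g : LeavittGenerator V Edge)
    {b : Unitization K (LeavittPathAlgebra K E)} (hb : b ∈ (family K E).monomialSpan K) :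
    ((mk (LeavittFree.ofGen K g) : LeavittPathAlgebra K E) :
      Unitization K (LeavittPathAlgebra K E)) * b ∈ (family K E).monomialSpan K := by
  induction hb using Submodule.span_induction with
  | zero => simp
  | add a b _ _ h1 h2 => rw [mul_add]; exact add_mem h1 h2
  | smul k a _ h => rw [mul_smul_comm]; exact Submodule.smul_mem _ k h
  | mem b h =>
    obtain ⟨l, m, v, rfl⟩ := h
    cases g with
    | vertex w => exact p_mul_monomial_mem K E (family K E) w v l m
    | edge e =>
      refine Submodule.subset_span ⟨e :: l, m, v, ?_⟩
      simp only [CohnFamily.real, mul_assoc]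
      rfl
    | ghost e =>
      change (family K E).y e * _ ∈ _
      cases l with
      | nil =>
        by_cases h : v = E.s e
        · subst h
          refine Submodule.subset_span ⟨[], m ++ [e], E.r e, ?_⟩
          simp only [CohnFamily.real, CohnFamily.ghost_append, CohnFamily.ghost, one_mul,
            ← mul_assoc, CohnFamily.y_mul_p, CohnFamily.p_mul_y]
        · convert Submodule.zero_mem _
          simp only [CohnFamily.real, one_mul, ← mul_assoc, CohnFamily.y_mul_p_ne _ h, zero_mul]
      | cons e' l =>
        by_cases h : e = e'
        · subst h
          convert p_mul_monomial_mem K E (family K E) (E.r e) v l m using 1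
          simp only [CohnFamily.real, ← mul_assoc, CohnFamily.y_mul_x_self]
        · convert Submodule.zero_mem _
          simp only [CohnFamily.real, ← mul_assoc, CohnFamily.y_mul_x_ne _ _ _ h, zero_mul]

theorem p_mem_monomialSpan {B : Type*} [Ring B] [Algebra K B] (F : CohnFamily E B) (v : V) :
    F.p v ∈ F.monomialSpan K :=
  Submodule.subset_span ⟨[], [], v, by simp [CohnFamily.real, CohnFamily.ghost]⟩

theorem inr_ofGen_mem (g : LeavittGenerator V Edge) :
    ((mk (LeavittFree.ofGen K g) : LeavittPathAlgebra K E) :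
      Unitization K (LeavittPathAlgebra K E)) ∈ (family K E).monomialSpan K := by
  cases g with
  | vertex v => exact p_mem_monomialSpan K E (family K E) v
  | edge e =>
    have h := inr_ofGen_mul_mem K E (.edge e) (p_mem_monomialSpan K E (family K E) (E.r e))
    have h' := (family K E).x_mul_p e
    exact (congrArg (· ∈ (family K E).monomialSpan K) h').mp h
  | ghost e =>
    have h := inr_ofGen_mul_mem K E (.ghost e) (p_mem_monomialSpan K E (family K E) (E.s e))
    have h' := (family K E).y_mul_p e
    exact (congrArg (· ∈ (family K E).monomialSpan K) h').mp h

theorem inr_mem_monomialSpan (a : LeavittPathAlgebra K E) :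
    (a : Unitization K (LeavittPathAlgebra K E)) ∈ (family K E).monomialSpan K := by
  obtain ⟨b, rfl⟩ := mk_surjective a
  induction b using MonoidAlgebra.induction_linear with
  | zero => rw [mk_zero, Unitization.inr_zero]; exact Submodule.zero_mem _
  | add a b h1 h2 => rw [mk_add, Unitization.inr_add]; exact add_mem h1 h2
  | single w k =>
    rw [show MonoidAlgebra.single w k = k • (MonoidAlgebra.single w 1 : LeavittFree K V Edge) by
      simp, mk_smul, Unitization.inr_smul]
    refine Submodule.smul_mem _ k ?_
    induction w using FreeSemigroup.recOnMul with
    | ih1 g => exact inr_ofGen_mem K E g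
    | ih2 g w _ h =>
      rw [show (MonoidAlgebra.single (FreeSemigroup.of g * w) 1 : LeavittFree K V Edge)
        = LeavittFree.ofGen K g * MonoidAlgebra.single w 1 by simp [LeavittFree.ofGen], mk_mul,
        Unitization.inr_mul]
      exact inr_ofGen_mul_mem K E g h

variable {K E}

theorem vertex_mul_self (v : V) : vertex K E v * vertex K E v = vertex K E v := by
  rw [vertex, ← mk_mul, mk_eq_mk_of_rel E (.vertex_self v)]

/-- Apply `τ` to `r(e) = e* s(e) e` and let it act on the middle factor. -/
theorem centralizer_vertex_of_isPath {τ : Module.End K (LeavittPathAlgebra K E)}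
    (hτ : τ ∈ algebraCentroid K (LeavittPathAlgebra K E)) {k : K} {v w : V} {l : List Edge}
    (hl : E.IsPath v l w) (hv : τ (vertex K E v) = k • vertex K E v) :
    τ (vertex K E w) = k • vertex K E w := by
  induction l generalizing v with
  | nil => cases hl; exact hv
  | cons e l ih =>
    obtain ⟨rfl, hl⟩ := hl
    refine ih hl ?_
    have h : (mk (LeavittFree.g K e) : LeavittPathAlgebra K E) *
        (vertex K E (E.s e) * mk (LeavittFree.e K e)) = vertex K E (E.r e) := by
      rw [vertex, vertex, ← mk_mul, mk_eq_mk_of_rel E (.source_edge e), ← mk_mul,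
        mk_eq_mk_of_rel E (.ck1_self e)]
    rw [← h, (hτ _ _).2, (hτ _ _).1, hv, smul_mul_assoc, mul_smul_comm]

theorem centralizer_vertex_of_exit {τ : Module.End K (LeavittPathAlgebra K E)}
    (hτ : τ ∈ algebraCentroid K (LeavittPathAlgebra K E)) {u : V} {c : List Edge} {f : Edge}
    (hc : c ≠ []) (hcu : E.IsPath u c u) (hf : f ∉ c) (hu : E.s f = u) :
    ∃ k : K, τ (vertex K E u) = k • vertex K E u := by
  have huu := vertex_mul_self (K := K) (E := E) u
  have h1 : vertex K E u * τ (vertex K E u) = τ (vertex K E u) := by rw [← (hτ _ _).2, huu]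
  have h2 : τ (vertex K E u) * vertex K E u = τ (vertex K E u) := by rw [← (hτ _ _).1, huu]
  have hp : (family K E).p u = Unitization.inr (vertex K E u) := rfl
  obtain ⟨k, hk⟩ := (family K E).eq_smul_of_commute hc hcu hf hu
    (fun h => vertex_ne_zero E K (E.r f) (Unitization.inr_injective h))
    (inr_mem_monomialSpan K E (τ (vertex K E u)))
    (by rw [hp, ← Unitization.inr_mul, h1])
    (by rw [hp, ← Unitization.inr_mul, h2])
    (by
      intro b
      obtain ⟨y, hy⟩ : ∃ y : LeavittPathAlgebra K E,
          (y : Unitization K _) = (family K E).p u * b * (family K E).p u := by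
        -- The corner at `u` of the unitization already lies in the algebra: the scalar part of `b`
        -- contributes a multiple of `u`.
        refine ⟨b.fst • vertex K E u + vertex K E u * b.snd * vertex K E u, ?_⟩
        conv_rhs => rw [← Unitization.inl_fst_add_inr_snd_eq b]
        rw [hp, mul_add, add_mul, Unitization.inr_mul_inl, ← Unitization.inr_mul,
          ← Unitization.inr_mul, ← Unitization.inr_mul, ← Unitization.inr_add, smul_mul_assoc, huu]
      have hl : vertex K E u * y = y := by
        apply Unitization.inr_injective (R := K)
        rw [Unitization.inr_mul, ← hp, hy, ← mul_assoc, ← mul_assoc, CohnFamily.p_mul_self]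
      have hr : y * vertex K E u = y := by
        apply Unitization.inr_injective (R := K)
        rw [Unitization.inr_mul, ← hp, hy, mul_assoc, CohnFamily.p_mul_self]
      -- Both products equal `τ(y)`, as `τ(u)y = τ(uy)` and `yτ(u) = τ(yu)`.
      rw [← hy, ← Unitization.inr_mul, ← Unitization.inr_mul, ← (hτ _ _).1, ← (hτ _ _).2, hl, hr])
  exact ⟨k, Unitization.inr_injective (R := K) (by rw [hk, Unitization.inr_smul]; rfl)⟩

theorem centralizer_vertex_of_isCycleAt {τ : Module.End K (LeavittPathAlgebra K E)}
    (hτ : τ ∈ algebraCentroid K (LeavittPathAlgebra K E)) {u : V} {c : List Edge}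
    (hc : E.IsCycleAt c u) {f : Edge} (hf : E.IsExit f c) :
    ∃ k : K, τ (vertex K E u) = k • vertex K E u := by
  obtain ⟨hne, hchain, hs, hr, hnodup⟩ := hc
  obtain ⟨e, hec, hfe, hne'⟩ := hf
  have hpath := DirectedGraph.isPath_of_isChain hne hchain
  rw [hs, hr] at hpath
  -- Distinct sources: an edge of `c` with the source of `e` must be `e`.
  have hfc : f ∉ c := fun h => hne' (List.inj_on_of_nodup_map hnodup h hec hfe)
  obtain ⟨l, m, rfl⟩ := List.append_of_mem hec
  obtain ⟨v, hl, hm⟩ := hpath.split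
  obtain rfl : E.s e = v := hm.1
  -- Rotate the cycle to start at the source of the exit; the segment `e :: m` then carries the
  -- scalar back to `u`.
  obtain ⟨k, hk⟩ := centralizer_vertex_of_exit (K := K) hτ (c := e :: m ++ l) (by simp)
    (hm.append hl) (f := f) (by simpa [or_comm, or_left_comm, or_assoc] using hfc) hfe
  exact ⟨k, centralizer_vertex_of_isPath hτ hm hk⟩

end Family

end LeavittPathAlgebra

/-! ### Prime algebras and the main theorem -/

/-- In a prime algebra a centralizer that vanishes at a nonzero element is zero. -/
theorem eq_zero_of_mem_algebraCentroid {K A : Type*} [Field K] [NonUnitalRing A] [Module K A]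
    [IsScalarTower K A A] [SMulCommClass K A A] (hA : IsPrimeRing A) {σ : Module.End K A}
    (hσ : σ ∈ algebraCentroid K A) {a : A} (ha : a ≠ 0) (h : σ a = 0) : σ = 0 := by
  let I : TwoSidedIdeal A := .mk' {x | σ x = 0} (map_zero σ)
    (fun {x y} hx hy => by rw [Set.mem_ofPred_eq] at *; rw [map_add, hx, hy, add_zero])
    (fun {x} hx => by rw [Set.mem_ofPred_eq] at *; rw [map_neg, hx, neg_zero])
    (fun {x y} hy => by rw [Set.mem_ofPred_eq] at *; rw [(hσ x y).2, hy, mul_zero])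
    (fun {x y} hx => by rw [Set.mem_ofPred_eq] at *; rw [(hσ x y).1, hx, zero_mul])
  let J : TwoSidedIdeal A := .mk' (Set.range σ) ⟨0, map_zero σ⟩
    (by rintro _ _ ⟨x, rfl⟩ ⟨y, rfl⟩; exact ⟨x + y, map_add σ x y⟩)
    (by rintro _ ⟨x, rfl⟩; exact ⟨-x, map_neg σ x⟩)
    (by rintro x _ ⟨y, rfl⟩; exact ⟨x * y, (hσ x y).2⟩)
    (by rintro _ y ⟨x, rfl⟩; exact ⟨x * y, (hσ x y).1⟩)
  have hI (x : A) : x ∈ I ↔ σ x = 0 := TwoSidedIdeal.mem_mk' ..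
  have hJ (x : A) : x ∈ J ↔ x ∈ Set.range σ := TwoSidedIdeal.mem_mk' ..
  -- Kernel times range vanishes: `x σ(z) = σ(x) z = 0`.
  rcases hA I J (fun x hx y hy => by
    obtain ⟨z, rfl⟩ := (hJ y).1 hy
    rw [← (hσ x z).2, (hσ x z).1, (hI x).1 hx, zero_mul]) with hbot | hbot
  · have := (hI a).2 h
    rw [hbot, TwoSidedIdeal.mem_bot] at this
    exact absurd this ha
  · ext x
    have := (hJ (σ x)).2 ⟨x, rfl⟩
    rwa [hbot, TwoSidedIdeal.mem_bot] at this

theorem mainTheorem6 {K : Type*} [Field K] {V Edge : Type*} (E : DirectedGraph V Edge) :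
    (∀ (u : V) (c : List Edge), E.IsCycleAt c u → (∃ e, E.IsExit e c) →
      ∀ τ ∈ algebraCentroid K (LeavittPathAlgebra K E),
        ∃ k : K, τ (LeavittPathAlgebra.vertex K E u) = k • LeavittPathAlgebra.vertex K E u) ∧
    (IsPrimeRing (LeavittPathAlgebra K E) →
      (∃ (u : V) (c : List Edge), E.IsCycleAt c u ∧ ∃ e, E.IsExit e c) →
        Nonempty (algebraCentroid K (LeavittPathAlgebra K E) ≃ₐ[K] K)) := by
  refine ⟨fun u c hc ⟨e, he⟩ τ hτ =>
    LeavittPathAlgebra.centralizer_vertex_of_isCycleAt hτ hc he, fun hA ⟨u, c, hc, e, he⟩ => ?_⟩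
  have hu := LeavittPathAlgebra.vertex_ne_zero E K u
  refine ⟨(AlgEquiv.ofBijective
    (Algebra.ofId K (algebraCentroid K (LeavittPathAlgebra K E))) ⟨fun k l h => ?_, ?_⟩).symm⟩
  · have h' := LinearMap.congr_fun (congrArg Subtype.val h) (LeavittPathAlgebra.vertex K E u)
    exact smul_left_injective K hu h'
  · rintro ⟨τ, hτ⟩
    obtain ⟨k, hk⟩ := LeavittPathAlgebra.centralizer_vertex_of_isCycleAt hτ hc he
    refine ⟨k, Subtype.ext ?_⟩
    change algebraMap K (Module.End K (LeavittPathAlgebra K E)) k = τ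
    refine (sub_eq_zero.1 (eq_zero_of_mem_algebraCentroid hA
      (sub_mem hτ (Subalgebra.algebraMap_mem _ k)) hu ?_)).symm
    rw [LinearMap.sub_apply, hk, Module.algebraMap_end_apply, sub_self]
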